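/- For each $n$, consider $n$ transmitter--receiver links with channel coefficients $g_{ji}$, $1\le i,j\le n$ (from transmitter $j$ to receiver $i$), that are independent exponential random variables with mean $1$. The double-threshold-based link activation strategy (DTBLAS) with thresholds $\Delta=\Delta_n$ and $\delta$ first chooses the largest set $\mathcal A_1\subseteq\{1,\dots,n\}$ such that $g_{ii}>\Delta$ for all $i\in\mathcal A_1$, and then a largest set $\mathcal A_2\subseteq\mathcal A_1$ such that $g_{ij}\le\delta$ and $g_{ji}\le\delta$ for all distinct $i,j\in\mathcal A_2$; the links in $\mathcal A_2$ are the active links, and $k_{\mathrm{DTBLAS}}=|\mathcal A_2|$. Let $\delta>0$ and $\epsilon>0$ be fixed, let $\Delta=\Delta_n\ge 0$ for all sufficiently large $n$, and suppose that $ne^{-\Delta}\to\infty$ as $n\to\infty$. Put $p=(1-e^{-\delta})^2$ and $b=1/p=(1-e^{-\delta})^{-2}$. Then $\mathrm P(k'_-\le k_{\mathrm{DTBLAS}}\le k'_+)\to 1$ as $n\to\infty$, where $$k'_\pm=\Big\lfloor 2\log_b\big(ne^{-\Delta}\big)-2\log_b\Big(\log_b\big(ne^{-\Delta}(1-\tfrac1b)\big)\Big)+2\log_b\tfrac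 e2+1\pm\frac{\epsilon}{p}+o(1)\Big\rfloor ,$$ and the $o(1)$ terms (one for each sign) are suitable deterministic sequences that tend to $0$ as $n\to\infty$. -/

import Mathlib

open MeasureTheory ProbabilityTheory Filter Topology

/-- Rayleigh fading: `g j i` is the coefficient of the channel from transmitter `j` to receiver `i`
of a network with `n` links. All `n * n` coefficients (direct and cross) are independent and
exponentially distributed with mean one. -/
structure IsRayleighFading {n : ℕ} {Ω : Type*} [MeasurableSpace Ω] (P : Measure Ω)
    (g : Fin n → Fin n → Ω → ℝ) : Prop where
  law : ∀ j i, HasLaw (g j i) (expMeasure 1) P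
  indep : iIndepFun (fun q : Fin n × Fin n => g q.1 q.2) P

/-- `A` is a largest (maximum cardinality) set of links having the property `p`. -/
def IsLargest {n : ℕ} (p : Finset (Fin n) → Prop) (A : Finset (Fin n)) : Prop :=
  p A ∧ ∀ B : Finset (Fin n), p B → B.card ≤ A.card

/-- `A` is a possible set of active links of the double-threshold-based link activation strategy
with thresholds `Δ` and `δ`, for the channel coefficients `g`: first a largest set `A₁` of links
whose direct coefficients exceed `Δ` is chosen, then a largest subset of `A₁` whose mutual cross
coefficients are at most `δ`. -/
def IsDTBLASActiveSet {n : ℕ} (g : Fin n → Fin n → ℝ) (Δ δ : ℝ) (A : Finset (Fin n)) : Prop :=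
  ∃ A₁ : Finset (Fin n),
    IsLargest (fun B => ∀ i ∈ B, Δ < g i i) A₁ ∧
    IsLargest (fun B => B ⊆ A₁ ∧ ∀ i ∈ B, ∀ j ∈ B, i ≠ j → g i j ≤ δ ∧ g j i ≤ δ) A

/-- The probability that two given links have both mutual cross coefficients at most `δ`. -/
noncomputable def edgeProb (δ : ℝ) : ℝ := (1 - Real.exp (-δ)) ^ 2

/-- The base `b` of the logarithms. -/
noncomputable def logBase (δ : ℝ) : ℝ := (1 - Real.exp (-δ)) ^ (-2 : ℤ)

/-- `⌊2 log_b x - 2 log_b (log_b (x (1 - 1/b))) + 2 log_b (e/2) + 1 + s + u⌋`;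
used with `x = n e^{-Δ}`, `s = ± ε / p`, and `u` the `o(1)` term. -/
noncomputable def activeLinksBound (δ x s u : ℝ) : ℤ :=
  ⌊2 * Real.logb (logBase δ) x
    - 2 * Real.logb (logBase δ) (Real.logb (logBase δ) (x * (1 - 1 / logBase δ)))
    + 2 * Real.logb (logBase δ) (Real.exp 1 / 2) + 1 + s + u⌋

/-! Put `a = e^{-Δ}`, `s = 1 - e^{-δ}`, `x = na`. A largest `A₁` contains every link with a strong
direct channel, so at least `r` links are active exactly when some `r`-set is compatible
(`IsDTBLASActiveSet.le_card_iff`). This is a clique problem with edge probability `s²` on randomly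
retained vertices.

The expected number of compatible `r`-sets is `C(n,r) a^r s^{r(r-1)} ≤ (e x s^{r-1}/r)^r`. The base
of this power crosses 1 within `o(1)` of `typicalSize`, and moving `r` a distance `σ = ε/p` away
gains a fixed factor (`eventually_sizeRatio`). Above the typical size the expectation therefore
tends to 0.

Below it the second moment method applies: the probability that no `r`-set is compatible is at most
`∑ C(r,l)² / (C(n,l) W(l))` over overlaps `1 ≤ l ≤ r`, where `W(l) = a^l s^{l(l-1)}`. Small overlaps
are controlled by `r²/√x`, large ones by the fixed factor raised to the power `l`
(`choose_sq_div_le`). Since `r = O(log x)`, the sum vanishes. -/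

/-! ### Second moment inequality for finitely many events -/

section SecondMoment

variable {Ω : Type*} [MeasurableSpace Ω] {P : Measure Ω}

/-- Null-measurability is the right generality: the coefficients are only a.e. measurable, so the
compatibility events need not be measurable. -/
theorem integrable_indicator_one_of_nullMeasurableSet [IsProbabilityMeasure P] {s : Set Ω}
    (hs : NullMeasurableSet s P) : Integrable (s.indicator (1 : Ω → ℝ)) P := by
  refine (Integrable.congr ?_ (indicator_ae_eq_of_ae_eq_set hs.toMeasurable_ae_eq))
  exact (integrable_const (1 : ℝ)).indicator (measurableSet_toMeasurable P s)

theorem integral_indicator_one_of_nullMeasurableSet {s : Set Ω} (hs : NullMeasurableSet s P) :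
    ∫ ω, s.indicator (1 : Ω → ℝ) ω ∂P = P.real s := by
  rw [← integral_congr_ae (indicator_ae_eq_of_ae_eq_set hs.toMeasurable_ae_eq),
    integral_indicator_one (measurableSet_toMeasurable P s), Measure.real, Measure.real,
    measure_toMeasurable]

/-- The second moment method for a finite family of events. -/
theorem measureReal_forall_notMem_mul_sq_le [IsProbabilityMeasure P] {ι : Type*} (I : Finset ι)
    (V : ι → Set Ω) (hV : ∀ i, NullMeasurableSet (V i) P) :
    P.real {ω | ∀ i ∈ I, ω ∉ V i} * (∑ i ∈ I, P.real (V i)) ^ 2 ≤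
      ∑ i ∈ I, ∑ j ∈ I, P.real (V i ∩ V j) - (∑ i ∈ I, P.real (V i)) ^ 2 := by
  set M := ∑ i ∈ I, P.real (V i)
  have hE : NullMeasurableSet {ω | ∀ i ∈ I, ω ∉ V i} P := by
    have : {ω | ∀ i ∈ I, ω ∉ V i} = ⋂ i ∈ I, (V i)ᶜ := by ext; simp
    rw [this]
    exact .biInter I.countable_toSet fun i _ => (hV i).compl
  have hVi := fun i => integrable_indicator_one_of_nullMeasurableSet (hV i)
  have hVij := fun i j => integrable_indicator_one_of_nullMeasurableSet ((hV i).inter (hV j))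
  have hsum : Integrable (fun ω => ∑ i ∈ I, (V i).indicator (1 : Ω → ℝ) ω) P :=
    integrable_finsetSum _ fun i _ => hVi i
  have hsum₂ : Integrable (fun ω => ∑ i ∈ I, ∑ j ∈ I, (V i ∩ V j).indicator (1 : Ω → ℝ) ω) P :=
    integrable_finsetSum _ fun i _ => integrable_finsetSum _ fun j _ => hVij i j
  have hsub : Integrable (fun ω => (∑ i ∈ I, ∑ j ∈ I, (V i ∩ V j).indicator (1 : Ω → ℝ) ω)
      - 2 * M * (∑ i ∈ I, (V i).indicator (1 : Ω → ℝ) ω)) P := hsum₂.sub (hsum.const_mul _)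
  -- With `N` the number of events that occur, this integrates `1_{N = 0} M² ≤ (N - M)²`, written
  -- out as `N² - 2MN + M²`.
  have key : ∫ ω, {ω | ∀ i ∈ I, ω ∉ V i}.indicator (1 : Ω → ℝ) ω * M ^ 2 ∂P ≤
      ∫ ω, ((∑ i ∈ I, ∑ j ∈ I, (V i ∩ V j).indicator (1 : Ω → ℝ) ω)
        - 2 * M * (∑ i ∈ I, (V i).indicator (1 : Ω → ℝ) ω) + M ^ 2) ∂P := by
    refine integral_mono ((integrable_indicator_one_of_nullMeasurableSet hE).mul_const _)
      (hsub.add (integrable_const _)) fun ω => ?_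
    have hsq : ∑ i ∈ I, ∑ j ∈ I, (V i ∩ V j).indicator (1 : Ω → ℝ) ω =
        (∑ i ∈ I, (V i).indicator (1 : Ω → ℝ) ω) ^ 2 := by
      rw [sq, Finset.sum_mul_sum]
      simp only [Set.inter_indicator_one, Pi.mul_apply]
    dsimp only
    rw [hsq]
    by_cases hω : ω ∈ {ω | ∀ i ∈ I, ω ∉ V i}
    · have h0 : ∑ i ∈ I, (V i).indicator (1 : Ω → ℝ) ω = 0 :=
        Finset.sum_eq_zero fun i hi => Set.indicator_of_notMem (hω i hi) _
      rw [h0, Set.indicator_of_mem hω]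
      simp
    · rw [Set.indicator_of_notMem hω]
      nlinarith [sq_nonneg ((∑ i ∈ I, (V i).indicator (1 : Ω → ℝ) ω) - M)]
  rw [integral_mul_const, integral_indicator_one_of_nullMeasurableSet hE,
    integral_add hsub (integrable_const _),
    integral_sub hsum₂ (hsum.const_mul _), integral_const_mul,
    integral_finsetSum _ fun i _ => hVi i,
    integral_finsetSum _ fun i _ => integrable_finsetSum _ fun j _ => hVij i j] at key
  simp_rw [integral_finsetSum I fun j _ => hVij _ j,
    integral_indicator_one_of_nullMeasurableSet ((hV _).inter (hV _)),
    integral_indicator_one_of_nullMeasurableSet (hV _)] at key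
  simp only [integral_const, probReal_univ, smul_eq_mul, one_mul] at key
  refine key.trans (le_of_eq ?_)
  ring

end SecondMoment

/-! ### Counting sets by their overlap -/

section Counting

/-- Sum over the `r`-subsets meeting a given `r`-subset, organised by the size of the
intersection. -/
theorem sum_powersetCard_inter_le {n r : ℕ} (S : Finset (Fin n)) (hS : S.card = r)
    (f : ℕ → ℝ) (hf : ∀ l, 0 ≤ f l) :
    ∑ T ∈ Finset.powersetCard r Finset.univ with (S ∩ T).card ≠ 0, f (S ∩ T).card ≤
      ∑ l ∈ Finset.Icc 1 r, (r.choose l : ℝ) * ((n - l).choose (r - l) : ℕ) * f l := by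
  classical
  have hmaps : ∀ T ∈ (Finset.powersetCard r (Finset.univ : Finset (Fin n))).filter
      (fun T => (S ∩ T).card ≠ 0), (S ∩ T).card ∈ Finset.Icc 1 r := by
    intro T hT
    have h1 : (S ∩ T).card ≤ r := hS ▸ Finset.card_le_card Finset.inter_subset_left
    simp only [Finset.mem_filter] at hT
    exact Finset.mem_Icc.2 ⟨Nat.one_le_iff_ne_zero.2 hT.2, h1⟩
  rw [← Finset.sum_fiberwise_of_maps_to hmaps]
  refine Finset.sum_le_sum fun l hl => ?_
  rw [Finset.sum_congr rfl (g := fun _ => f l)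
    (fun T hT => by rw [(Finset.mem_filter.1 hT).2]), Finset.sum_const, nsmul_eq_mul]
  refine mul_le_mul_of_nonneg_right ?_ (hf l)
  have hl' := Finset.mem_Icc.1 hl
  set I := ((Finset.powersetCard r (Finset.univ : Finset (Fin n))).filter
      (fun T => (S ∩ T).card ≠ 0)).filter (fun T => (S ∩ T).card = l) with hI
  -- `T` is recovered from `U = S ∩ T` and `T \ U`. Only disjointness of `T \ U` from `U`, not from
  -- `S`, is kept; this overcounts, but yields the binomial `C(n-l, r-l)` that later combines with
  -- `C(r,l)`.
  have hsub : I ⊆ (Finset.powersetCard l S).biUnion fun U =>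
      (Finset.powersetCard (r - l) Uᶜ).image fun W => U ∪ W := by
    intro T hT
    simp only [hI, Finset.mem_filter, Finset.mem_powersetCard] at hT
    simp only [Finset.mem_biUnion, Finset.mem_image, Finset.mem_powersetCard]
    refine ⟨S ∩ T, ⟨Finset.inter_subset_left, hT.2⟩, T \ (S ∩ T), ⟨?_, ?_⟩, ?_⟩
    · intro a ha
      exact Finset.mem_compl.2 (Finset.mem_sdiff.1 ha).2
    · rw [Finset.card_sdiff_of_subset Finset.inter_subset_right, hT.1.1.2, hT.2]
    · exact Finset.union_sdiff_of_subset Finset.inter_subset_right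
  have hcard : I.card ≤ r.choose l * (n - l).choose (r - l) := by
    refine (Finset.card_le_card hsub).trans ((Finset.card_biUnion_le_card_mul _ _ _ ?_).trans
      (le_of_eq (by rw [Finset.card_powersetCard, hS])))
    intro U hU
    refine Finset.card_image_le.trans (le_of_eq ?_)
    rw [Finset.card_powersetCard, Finset.card_compl, Fintype.card_fin,
      (Finset.mem_powersetCard.1 hU).2]
  exact_mod_cast hcard

end Counting

/-! ### Compatible sets and their first two moments -/

section Cliques

variable {Ω : Type*} {n : ℕ}

/-- All direct coefficients of the links of `S` exceed `Δ`, all mutual cross coefficients are at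
most `δ`. -/
def IsCompatible (g : Fin n → Fin n → ℝ) (Δ δ : ℝ) (S : Finset (Fin n)) : Prop :=
  ∀ q ∈ S ×ˢ S, g q.1 q.2 ∈ if q.1 = q.2 then Set.Ioi Δ else Set.Iic δ

theorem isCompatible_iff {g : Fin n → Fin n → ℝ} {Δ δ : ℝ} {S : Finset (Fin n)} :
    IsCompatible g Δ δ S ↔ (∀ i ∈ S, Δ < g i i) ∧ ∀ i ∈ S, ∀ j ∈ S, i ≠ j → g i j ≤ δ := by
  constructor
  · intro h
    refine ⟨fun i hi => ?_, fun i hi j hj hij => ?_⟩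
    · simpa using h (i, i) (Finset.mk_mem_product hi hi)
    · simpa [hij] using h (i, j) (Finset.mk_mem_product hi hj)
  · rintro ⟨h1, h2⟩ ⟨i, j⟩ hq
    obtain ⟨hi, hj⟩ := Finset.mem_product.1 hq
    by_cases hij : i = j
    · subst hij
      simpa using h1 i hi
    · simpa [hij] using h2 i hi j hj hij

theorem IsCompatible.mono {g : Fin n → Fin n → ℝ} {Δ δ : ℝ} {S T : Finset (Fin n)}
    (h : IsCompatible g Δ δ T) (hST : S ⊆ T) : IsCompatible g Δ δ S :=
  fun q hq => h q (Finset.product_subset_product hST hST hq)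

/-- The strategy activates at least `r` links if and only if there is a compatible set of `r`
links. -/
theorem IsDTBLASActiveSet.le_card_iff {g : Fin n → Fin n → ℝ} {Δ δ : ℝ} {A : Finset (Fin n)}
    (hA : IsDTBLASActiveSet g Δ δ A) (r : ℕ) :
    r ≤ A.card ↔ ∃ S ∈ Finset.powersetCard r Finset.univ, IsCompatible g Δ δ S := by
  classical
  obtain ⟨A₁, ⟨hA₁, hmax₁⟩, ⟨⟨hsub, hcross⟩, hmax⟩⟩ := hA
  constructor
  · intro hr
    obtain ⟨S, hSA, hS⟩ := Finset.exists_subset_card_eq hr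
    refine ⟨S, Finset.mem_powersetCard.2 ⟨Finset.subset_univ _, hS⟩, IsCompatible.mono ?_ hSA⟩
    exact isCompatible_iff.2
      ⟨fun i hi => hA₁ i (hsub hi), fun i hi j hj hij => (hcross i hi j hj hij).1⟩
  · rintro ⟨S, hS, hc⟩
    obtain ⟨h1, h2⟩ := isCompatible_iff.1 hc
    rw [← (Finset.mem_powersetCard.1 hS).2]
    refine hmax S ⟨fun i hi => ?_, fun i hi j hj hij => ⟨h2 i hi j hj hij, h2 j hj i hi hij.symm⟩⟩
    -- A strong link outside `A₁` could be added to it, contradicting maximality.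
    by_contra hiA
    have := hmax₁ (insert i A₁) fun j hj => by
      rcases Finset.mem_insert.1 hj with rfl | hj
      exacts [h1 _ hi, hA₁ j hj]
    rw [Finset.card_insert_of_notMem hiA] at this
    omega

/-- The probability that `k` given links are compatible, where `a` is the probability that a direct
coefficient is large and `s` the probability that a cross coefficient is small. -/
noncomputable def compatProb (a s : ℝ) (k : ℕ) : ℝ := a ^ k * s ^ (k * (k - 1))

theorem compatProb_pos {a s : ℝ} (ha : 0 < a) (hs : 0 < s) (k : ℕ) : 0 < compatProb a s k := by
  unfold compatProb; positivity

theorem prod_product_self_ite (a s : ℝ) (S : Finset (Fin n)) :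
    ∏ q ∈ S ×ˢ S, (if q.1 = q.2 then a else s) = compatProb a s S.card := by
  classical
  rw [Finset.prod_ite, Finset.prod_const, Finset.prod_const]
  have h1 : (S ×ˢ S).filter (fun q => q.1 = q.2) = S.diag := by
    ext ⟨i, j⟩; simp only [Finset.mem_filter, Finset.mem_product, Finset.mem_diag]; grind
  have h2 : (S ×ˢ S).filter (fun q => ¬ q.1 = q.2) = S.offDiag := by
    ext q; simp [Finset.mem_offDiag, and_assoc]
  rw [h1, h2, Finset.diag_card, Finset.offDiag_card, compatProb, Nat.mul_sub_one]

variable [MeasurableSpace Ω] {P : Measure Ω} {g : Fin n → Fin n → Ω → ℝ}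

theorem expMeasure_real_Iic {x : ℝ} (hx : 0 ≤ x) :
    (expMeasure 1).real (Set.Iic x) = 1 - Real.exp (-x) := by
  have := isProbabilityMeasure_expMeasure (r := 1) one_pos
  rw [← cdf_eq_real, cdf_expMeasure_eq one_pos, if_pos hx, one_mul]

theorem expMeasure_real_Ioi {x : ℝ} (hx : 0 ≤ x) :
    (expMeasure 1).real (Set.Ioi x) = Real.exp (-x) := by
  have := isProbabilityMeasure_expMeasure (r := 1) one_pos
  rw [← Set.compl_Iic, probReal_compl_eq_one_sub measurableSet_Iic, expMeasure_real_Iic hx]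
  ring

theorem measurableSet_threshold (Δ δ : ℝ) (q : Fin n × Fin n) :
    MeasurableSet (if q.1 = q.2 then Set.Ioi Δ else Set.Iic δ) := by
  split_ifs
  exacts [measurableSet_Ioi, measurableSet_Iic]

theorem IsRayleighFading.nullMeasurableSet (hg : IsRayleighFading P g) (Δ δ : ℝ)
    (S : Finset (Fin n)) :
    NullMeasurableSet {ω | IsCompatible (fun j i => g j i ω) Δ δ S} P := by
  have : {ω | IsCompatible (fun j i => g j i ω) Δ δ S} =
      ⋂ q ∈ S ×ˢ S, g q.1 q.2 ⁻¹' (if q.1 = q.2 then Set.Ioi Δ else Set.Iic δ) := by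
    ext; simp only [IsCompatible, Set.mem_ofPred_eq, Set.mem_iInter, Set.mem_preimage]
  rw [this]
  exact .biInter (S ×ˢ S).countable_toSet fun q _ =>
    (hg.law q.1 q.2).aemeasurable.nullMeasurableSet_preimage (measurableSet_threshold Δ δ q)

theorem IsRayleighFading.measureReal_forall (hg : IsRayleighFading P g) {Δ δ : ℝ} (hΔ : 0 ≤ Δ)
    (hδ : 0 ≤ δ) (Q : Finset (Fin n × Fin n)) :
    P.real {ω | ∀ q ∈ Q, g q.1 q.2 ω ∈ if q.1 = q.2 then Set.Ioi Δ else Set.Iic δ} =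
      ∏ q ∈ Q, if q.1 = q.2 then Real.exp (-Δ) else 1 - Real.exp (-δ) := by
  have : {ω | ∀ q ∈ Q, g q.1 q.2 ω ∈ if q.1 = q.2 then Set.Ioi Δ else Set.Iic δ} =
      ⋂ q ∈ Q, g q.1 q.2 ⁻¹' (if q.1 = q.2 then Set.Ioi Δ else Set.Iic δ) := by
    ext; simp only [Set.mem_ofPred_eq, Set.mem_iInter, Set.mem_preimage]
  rw [this, Measure.real,
    hg.indep.measure_inter_preimage_eq_mul Q fun q _ => measurableSet_threshold Δ δ q,
    ENNReal.toReal_prod]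
  refine Finset.prod_congr rfl fun q _ => ?_
  have hl := hg.law q.1 q.2
  rw [← Measure.map_apply_of_aemeasurable hl.aemeasurable (measurableSet_threshold Δ δ q),
    hl.map_eq]
  split_ifs
  exacts [expMeasure_real_Ioi hΔ, expMeasure_real_Iic hδ]

theorem IsRayleighFading.measureReal_isCompatible (hg : IsRayleighFading P g) {Δ δ : ℝ}
    (hΔ : 0 ≤ Δ) (hδ : 0 ≤ δ) (S : Finset (Fin n)) :
    P.real {ω | IsCompatible (fun j i => g j i ω) Δ δ S} =
      compatProb (Real.exp (-Δ)) (1 - Real.exp (-δ)) S.card := by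
  rw [← prod_product_self_ite, ← hg.measureReal_forall hΔ hδ]
  rfl

/-- The joint event constrains the coefficients indexed by `S ×ˢ S ∪ T ×ˢ T`, and the two squares
meet in the square of `S ∩ T`. The product form avoids a division. -/
theorem IsRayleighFading.measureReal_isCompatible_inter (hg : IsRayleighFading P g) {Δ δ : ℝ}
    (hΔ : 0 ≤ Δ) (hδ : 0 ≤ δ) (S T : Finset (Fin n)) :
    P.real ({ω | IsCompatible (fun j i => g j i ω) Δ δ S} ∩
        {ω | IsCompatible (fun j i => g j i ω) Δ δ T}) *
        compatProb (Real.exp (-Δ)) (1 - Real.exp (-δ)) (S ∩ T).card =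
      compatProb (Real.exp (-Δ)) (1 - Real.exp (-δ)) S.card *
        compatProb (Real.exp (-Δ)) (1 - Real.exp (-δ)) T.card := by
  classical
  have : {ω | IsCompatible (fun j i => g j i ω) Δ δ S} ∩
        {ω | IsCompatible (fun j i => g j i ω) Δ δ T} = {ω | ∀ q ∈ S ×ˢ S ∪ T ×ˢ T,
          g q.1 q.2 ω ∈ if q.1 = q.2 then Set.Ioi Δ else Set.Iic δ} := by
    ext ω
    simp only [IsCompatible, Set.mem_inter_iff, Set.mem_ofPred_eq, Finset.mem_union, or_imp,
      forall_and]
  rw [this, hg.measureReal_forall hΔ hδ, ← prod_product_self_ite, ← prod_product_self_ite,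
    ← prod_product_self_ite, ← Finset.product_inter_product, Finset.prod_union_inter]

/-- First moment bound. -/
theorem IsRayleighFading.measureReal_le_card_le [IsProbabilityMeasure P]
    (hg : IsRayleighFading P g) {Δ δ : ℝ} (hΔ : 0 ≤ Δ) (hδ : 0 ≤ δ) (r : ℕ) :
    P.real {ω | ∃ S ∈ Finset.powersetCard r Finset.univ,
        IsCompatible (fun j i => g j i ω) Δ δ S} ≤
      n.choose r * compatProb (Real.exp (-Δ)) (1 - Real.exp (-δ)) r := by
  have : {ω | ∃ S ∈ Finset.powersetCard r Finset.univ, IsCompatible (fun j i => g j i ω) Δ δ S} =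
      ⋃ S ∈ Finset.powersetCard r Finset.univ, {ω | IsCompatible (fun j i => g j i ω) Δ δ S} := by
    ext; simp
  rw [this]
  refine (measureReal_biUnion_finset_le _ _).trans (le_of_eq ?_)
  rw [Finset.sum_congr rfl fun S hS => by
    rw [hg.measureReal_isCompatible hΔ hδ, (Finset.mem_powersetCard.1 hS).2]]
  simp [Finset.card_powersetCard]

/-- Second moment bound. -/
theorem IsRayleighFading.measureReal_forall_not_le [IsProbabilityMeasure P]
    (hg : IsRayleighFading P g) {Δ δ : ℝ} (hΔ : 0 ≤ Δ) (hδ : 0 < δ) {r : ℕ} (hr : r ≤ n) :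
    P.real {ω | ∀ S ∈ Finset.powersetCard r Finset.univ,
        ¬ IsCompatible (fun j i => g j i ω) Δ δ S} ≤
      ∑ l ∈ Finset.Icc 1 r, (r.choose l : ℝ) ^ 2 /
        (n.choose l * compatProb (Real.exp (-Δ)) (1 - Real.exp (-δ)) l) := by
  classical
  set W := compatProb (Real.exp (-Δ)) (1 - Real.exp (-δ)) with hW
  have hWpos : ∀ k, 0 < W k := compatProb_pos (Real.exp_pos _)
    (by simpa using hδ)
  have hW0 : W 0 = 1 := by simp [hW, compatProb]
  set I := Finset.powersetCard r (Finset.univ : Finset (Fin n)) with hI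
  have hIcard : I.card = n.choose r := by simp [hI, Finset.card_powersetCard]
  have hC : (0 : ℝ) < n.choose r := by exact_mod_cast Nat.choose_pos hr
  set V := fun S : Finset (Fin n) => {ω | IsCompatible (fun j i => g j i ω) Δ δ S} with hV
  have hmain := measureReal_forall_notMem_mul_sq_le I V (hg.nullMeasurableSet Δ δ)
  have hM : ∑ S ∈ I, P.real (V S) = n.choose r * W r := by
    rw [Finset.sum_congr rfl fun S hS => by
      rw [hg.measureReal_isCompatible hΔ hδ.le, (Finset.mem_powersetCard.1 hS).2]]
    simp [hIcard, hW]
  have hpair : ∀ S ∈ I, ∀ T ∈ I, P.real (V S ∩ V T) = W r ^ 2 * (W (S ∩ T).card)⁻¹ := by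
    intro S hS T hT
    rw [← div_eq_mul_inv, eq_div_iff (hWpos _).ne',
      hg.measureReal_isCompatible_inter hΔ hδ.le, (Finset.mem_powersetCard.1 hS).2,
      (Finset.mem_powersetCard.1 hT).2, sq]
  set B := ∑ l ∈ Finset.Icc 1 r, (r.choose l : ℝ) * ((n - l).choose (r - l) : ℕ) * (W l)⁻¹ with hB
  have hrow : ∀ S ∈ I, ∑ T ∈ I, P.real (V S ∩ V T) ≤ W r ^ 2 * (n.choose r + B) := by
    intro S hS
    rw [Finset.sum_congr rfl (hpair S hS), ← Finset.mul_sum]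
    refine mul_le_mul_of_nonneg_left ?_ (sq_nonneg _)
    -- Sets disjoint from `S` contribute at most `C(n,r)`; summed over `S`, this is the squared
    -- mean, which cancels in the variance. Only `B` survives.
    rw [← Finset.sum_filter_add_sum_filter_not I (fun T => (S ∩ T).card = 0)]
    refine add_le_add ?_ (sum_powersetCard_inter_le S (Finset.mem_powersetCard.1 hS).2
      (fun l => (W l)⁻¹) fun l => (inv_pos.2 (hWpos l)).le)
    rw [Finset.sum_congr rfl (g := fun _ => (1 : ℝ)) fun T hT => by
      rw [(Finset.mem_filter.1 hT).2, hW0, inv_one]]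
    rw [Finset.sum_const, nsmul_eq_mul, mul_one, ← hIcard]
    exact_mod_cast Finset.card_filter_le _ _
  have hdouble : ∑ S ∈ I, ∑ T ∈ I, P.real (V S ∩ V T) ≤
      n.choose r * (W r ^ 2 * (n.choose r + B)) := by
    refine (Finset.sum_le_card_nsmul _ _ _ hrow).trans (le_of_eq ?_)
    rw [nsmul_eq_mul, hIcard]
  rw [hM] at hmain
  have hB' : B / n.choose r = ∑ l ∈ Finset.Icc 1 r, (r.choose l : ℝ) ^ 2 / (n.choose l * W l) := by
    rw [hB, Finset.sum_div]
    refine Finset.sum_congr rfl fun l hl => ?_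
    have hlr := (Finset.mem_Icc.1 hl).2
    have h1 : (n.choose r : ℝ) * r.choose l = n.choose l * ((n - l).choose (r - l) : ℕ) := by
      exact_mod_cast Nat.choose_mul hlr
    have h2 : (0 : ℝ) < n.choose l := by exact_mod_cast Nat.choose_pos (hlr.trans hr)
    have h3 := hWpos l
    field_simp
    linear_combination -(r.choose l : ℝ) * h1
  rw [← hB', le_div_iff₀ hC]
  have hpos : 0 < (n.choose r : ℝ) * W r ^ 2 := mul_pos hC (pow_pos (hWpos r) 2)
  refine le_of_mul_le_mul_right ?_ hpos
  calc _ = P.real {ω | ∀ i ∈ I, ω ∉ V i} * (n.choose r * W r) ^ 2 := by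
        simp only [hV, Set.mem_ofPred_eq]; ring
    _ ≤ _ := hmain
    _ ≤ n.choose r * (W r ^ 2 * (n.choose r + B)) - (n.choose r * W r) ^ 2 := by gcongr
    _ = _ := by ring

end Cliques

/-! ### Estimates for factorials, binomials and overlap terms -/

section Estimates

/-- Induction; the step is `e l^{l+1} ≤ (l+1)^{l+1}`, from `1 - t ≤ e^{-t}` at `t = 1/(l+1)`. -/
theorem factorial_le_exp_one_mul {l : ℕ} (hl : 1 ≤ l) :
    (l.factorial : ℝ) ≤ Real.exp 1 * l * (l / Real.exp 1) ^ l := by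
  induction l, hl using Nat.le_induction with
  | base => simp [Real.exp_ne_zero]
  | succ l hl ih =>
    have hl0 : (0 : ℝ) < l := by exact_mod_cast hl
    have he := Real.exp_pos 1
    have key : (l : ℝ) ^ (l + 1) * Real.exp 1 ≤ ((l : ℝ) + 1) ^ (l + 1) := by
      have h1 : (l : ℝ) / (l + 1) ≤ Real.exp (-(1 / (l + 1))) := by
        refine le_trans (le_of_eq ?_) (Real.add_one_le_exp _)
        field_simp; ring
      have h2 : ((l : ℝ) / (l + 1)) ^ (l + 1) ≤ Real.exp (-1) := by
        refine (pow_le_pow_left₀ (by positivity) h1 _).trans (le_of_eq ?_)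
        rw [← Real.exp_nat_mul]
        congr 1
        push_cast
        field_simp
      rw [div_pow, div_le_iff₀ (by positivity), Real.exp_neg] at h2
      calc (l : ℝ) ^ (l + 1) * Real.exp 1
          ≤ (Real.exp 1)⁻¹ * ((l : ℝ) + 1) ^ (l + 1) * Real.exp 1 := by gcongr
        _ = _ := by field_simp
    rw [Nat.factorial_succ]
    push_cast
    calc ((l : ℝ) + 1) * l.factorial
        ≤ (l + 1) * (Real.exp 1 * l * (l / Real.exp 1) ^ l) := by gcongr
      _ = (l + 1) * ((l : ℝ) ^ (l + 1) * Real.exp 1) / Real.exp 1 ^ l := by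
        rw [div_pow, pow_succ (l : ℝ)]; field_simp
      _ ≤ (l + 1) * ((l : ℝ) + 1) ^ (l + 1) / Real.exp 1 ^ l := by gcongr
      _ = _ := by rw [div_pow, pow_succ (Real.exp 1)]; field_simp

theorem choose_mul_compatProb_le {a s : ℝ} (ha : 0 < a) (hs : 0 < s) (n : ℕ) {r : ℕ} (hr : 1 ≤ r) :
    n.choose r * compatProb a s r ≤ (Real.exp 1 * (n * a) * s ^ (r - 1) / r) ^ r := by
  have hr0 : (0 : ℝ) < r := by exact_mod_cast hr
  have h1 : (r : ℝ) ^ r / r.factorial ≤ Real.exp 1 ^ r := by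
    rw [← Real.exp_nat_mul, mul_one]
    exact Real.pow_div_factorial_le_exp r hr0.le r
  have hf : (0 : ℝ) < r.factorial := by exact_mod_cast r.factorial_pos
  calc n.choose r * compatProb a s r
      ≤ (n : ℝ) ^ r / r.factorial * (a ^ r * s ^ (r * (r - 1))) := by
        unfold compatProb
        gcongr
        exact Nat.choose_le_pow_div r n
    _ = (r : ℝ) ^ r / r.factorial * ((n * a) * s ^ (r - 1) / r) ^ r := by
        rw [div_pow, mul_pow, mul_pow, mul_comm r, pow_mul]; field_simp
    _ ≤ Real.exp 1 ^ r * ((n * a) * s ^ (r - 1) / r) ^ r := by gcongr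
    _ = _ := by rw [← mul_pow]; ring

/-- Bernoulli's inequality gives `(1 - l/n)^l ≥ 1 - l²/n ≥ 1/2`. -/
theorem pow_le_two_mul_factorial_mul_choose {n l : ℕ} (h : 2 * l ^ 2 ≤ n) :
    (n : ℝ) ^ l ≤ 2 * (l.factorial * n.choose l) := by
  rcases Nat.eq_zero_or_pos l with rfl | hl
  · simp
  have hln : l ≤ n := by nlinarith
  have hn : (0 : ℝ) < n := by exact_mod_cast (hl.trans_le hln)
  have h1 : ((n + 1 - l : ℕ) : ℝ) ^ l ≤ l.factorial * n.choose l := by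
    exact_mod_cast (Nat.pow_sub_le_descFactorial n l).trans_eq
      (Nat.descFactorial_eq_factorial_mul_choose n l)
  have h2 : (n : ℝ) * (1 - l / n) ≤ (n + 1 - l : ℕ) := by
    rw [Nat.cast_sub (by omega)]
    push_cast
    field_simp
    linarith
  have hln' : (l : ℝ) / n ≤ 1 := by
    rw [div_le_one hn]; exact_mod_cast hln
  have h3 : 1 / 2 ≤ (1 - (l : ℝ) / n) ^ l := by
    have := one_add_mul_le_pow (a := -((l : ℝ) / n)) (by linarith) l
    have h4 : (l : ℝ) * (l / n) ≤ 1 / 2 := by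
      have : (2 : ℝ) * l ^ 2 ≤ n := by exact_mod_cast h
      rw [← mul_div_assoc, div_le_iff₀ hn]
      nlinarith
    calc (1 : ℝ) / 2 ≤ 1 + l * -(l / n) := by linarith
      _ ≤ _ := this
      _ = _ := by ring
  calc (n : ℝ) ^ l = 2 * (n ^ l * (1 / 2)) := by ring
    _ ≤ 2 * (n ^ l * (1 - (l : ℝ) / n) ^ l) := by gcongr
    _ = 2 * ((n * (1 - (l : ℝ) / n)) ^ l) := by rw [mul_pow]
    _ ≤ 2 * (((n + 1 - l : ℕ) : ℝ) ^ l) := by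
        gcongr
    _ ≤ _ := by gcongr

/-- The contribution of the pairs of `r`-sets with `l` common links to the second moment. -/
theorem choose_sq_div_le {a s x θ η : ℝ} {n r l : ℕ} (ha : 0 < a) (hs : 0 < s)
    (hx : (n : ℝ) * a = x) (hx0 : 0 < x) (hl : 1 ≤ l) (hlr : l ≤ r) (hn : 2 * r ^ 2 ≤ n)
    (hrx : (r : ℝ) ^ 2 ≤ √x) (hθ0 : 0 < θ) (hη0 : 0 < η)
    (hθ : r * s⁻¹ ^ (r - 1) / (Real.exp 1 * x) ≤ θ)
    (hη : √x < s⁻¹ ^ (l - 1) → θ ^ l ≤ η) (hs1 : s ≤ 1) :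
    (r.choose l : ℝ) ^ 2 / (n.choose l * compatProb a s l) ≤
      2 * (r ^ 2 / √x + Real.exp 1 * r * η) := by
  set β := s⁻¹ with hβ
  have hβ1 : 1 ≤ β := (one_le_inv₀ hs).2 hs1
  have hβ0 : 0 < β := by linarith
  have he := Real.exp_pos 1
  have hsx : 0 < √x := Real.sqrt_pos.2 hx0
  have hsxx : √x * √x = x := Real.mul_self_sqrt hx0.le
  have hl0 : (0 : ℝ) < l := by exact_mod_cast hl
  have hr0 : (1 : ℝ) ≤ r := by exact_mod_cast hl.trans hlr
  have hln : l ≤ n := by nlinarith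
  have hC : (0 : ℝ) < n.choose l := by exact_mod_cast Nat.choose_pos hln
  have hf : (0 : ℝ) < l.factorial := by exact_mod_cast l.factorial_pos
  have hc0 : (0 : ℝ) ≤ r.choose l := Nat.cast_nonneg _
  have hl2 : 2 * l ^ 2 ≤ n := le_trans (by gcongr) hn
  have hmain : (r.choose l : ℝ) ^ 2 / (n.choose l * compatProb a s l) ≤
      2 * ((r.choose l : ℝ) ^ 2 * l.factorial * (β ^ (l - 1) / x) ^ l) := by
    have hpos : 0 < (n.choose l : ℝ) * compatProb a s l := mul_pos hC (compatProb_pos ha hs l)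
    rw [div_le_iff₀ hpos]
    have e : (β ^ (l - 1) / x) ^ l * compatProb a s l * n ^ l = 1 := by
      have hn0 : (0 : ℝ) < n := by exact_mod_cast (hl.trans hln)
      rw [compatProb, mul_comm l, pow_mul s, ← hx, hβ, inv_pow, div_pow, inv_pow, mul_pow]
      have : 0 < (s ^ (l - 1)) ^ l := by positivity
      field_simp
    have h2 := pow_le_two_mul_factorial_mul_choose hl2
    have hW := compatProb_pos ha hs l
    calc (r.choose l : ℝ) ^ 2
        = (r.choose l : ℝ) ^ 2 * ((β ^ (l - 1) / x) ^ l * compatProb a s l * n ^ l) := by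
          rw [e, mul_one]
      _ ≤ (r.choose l : ℝ) ^ 2 * ((β ^ (l - 1) / x) ^ l * compatProb a s l *
            (2 * (l.factorial * n.choose l))) := by gcongr
      _ = _ := by ring
  refine hmain.trans (mul_le_mul_of_nonneg_left ?_ zero_le_two)
  rcases le_or_gt (β ^ (l - 1)) (√x) with hcase | hcase
  -- Small overlap: the term is at most `(r²/√x)^l`, with base at most 1.
  · have h1 : (r.choose l : ℝ) * l.factorial ≤ (r : ℝ) ^ l := by
      rw [mul_comm]
      exact_mod_cast (Nat.descFactorial_eq_factorial_mul_choose r l).symm.trans_le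
        (Nat.descFactorial_le_pow r l)
    have h2 : (r.choose l : ℝ) ≤ (r : ℝ) ^ l := by exact_mod_cast Nat.choose_le_pow r l
    have h3 : β ^ (l - 1) / x ≤ 1 / √x := by
      rw [div_le_div_iff₀ hx0 hsx, one_mul]
      exact (mul_le_mul_of_nonneg_right hcase hsx.le).trans_eq hsxx
    have h4 : (r : ℝ) ^ 2 / √x ≤ 1 := (div_le_one hsx).2 hrx
    calc (r.choose l : ℝ) ^ 2 * l.factorial * (β ^ (l - 1) / x) ^ l
        = r.choose l * (r.choose l * l.factorial) * (β ^ (l - 1) / x) ^ l := by ring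
      _ ≤ (r : ℝ) ^ l * (r : ℝ) ^ l * (1 / √x) ^ l := by gcongr
      _ = ((r : ℝ) ^ 2 / √x) ^ l := by rw [← mul_pow, ← mul_pow]; ring
      _ ≤ (r : ℝ) ^ 2 / √x := pow_le_of_le_one (by positivity) h4 (by omega)
      _ ≤ _ := le_add_of_nonneg_right (by positivity)
  -- Large overlap, `r = l + m`: here `r² ≤ √x < β^{l-1}`, so `C(r,m)² ≤ r^{2m} ≤ β^{lm}`. This
  -- completes `β^{l-1}` to `β^{r-1}` inside the `l`-th power, where `θ` bounds the base.
  · obtain ⟨m, rfl⟩ := Nat.exists_eq_add_of_le hlr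
    have h1 : ((l + m).choose l : ℝ) ^ 2 ≤ (((l + m : ℕ) : ℝ) ^ 2) ^ m := by
      rw [Nat.choose_symm_add, ← pow_mul, mul_comm, pow_mul]
      gcongr
      exact_mod_cast Nat.choose_le_pow (l + m) m
    have h2 : (l : ℝ) * (β ^ (l - 1) / x) / Real.exp 1 * β ^ m ≤ θ := by
      refine le_trans (le_of_eq_of_le ?_ (mul_le_mul_of_nonneg_right
        (show (l : ℝ) ≤ (l + m : ℕ) by push_cast; linarith [(Nat.cast_nonneg m : (0:ℝ) ≤ m)])
        (show 0 ≤ β ^ (l + m - 1) / (Real.exp 1 * x) by positivity))) ((mul_div_assoc _ _ _).symm.trans_le hθ)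
      rw [show l + m - 1 = l - 1 + m by omega, pow_add]
      field_simp
    have h3 : ((l + m : ℕ) : ℝ) ^ 2 ≤ β ^ l :=
      hrx.trans (hcase.le.trans (pow_le_pow_right₀ hβ1 (by omega)))
    calc ((l + m).choose l : ℝ) ^ 2 * l.factorial * (β ^ (l - 1) / x) ^ l
        ≤ (β ^ l) ^ m * (Real.exp 1 * l * (l / Real.exp 1) ^ l) * (β ^ (l - 1) / x) ^ l := by
          gcongr
          · exact h1.trans (by gcongr)
          · exact factorial_le_exp_one_mul hl
      _ = Real.exp 1 * l * ((l : ℝ) * (β ^ (l - 1) / x) / Real.exp 1 * β ^ m) ^ l := by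
          rw [← pow_mul, mul_comm l m, pow_mul]
          rw [show (l : ℝ) * (β ^ (l - 1) / x) / Real.exp 1 * β ^ m =
            l / Real.exp 1 * (β ^ (l - 1) / x) * β ^ m by ring, mul_pow, mul_pow]
          ring
      _ ≤ Real.exp 1 * l * θ ^ l := by gcongr
      _ ≤ Real.exp 1 * (l + m : ℕ) * η := by
          gcongr
          exact hη hcase
      _ ≤ _ := le_add_of_nonneg_left (by positivity)

end Estimates

/-! ### Asymptotics around the typical size -/

section Asymptotics

/-- The approximate location `2 log_b x - 2 log_b log_b (x (1 - 1/b)) + 2 log_b (e/2) + 1` of the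
largest compatible set. -/
noncomputable def typicalSize (b x : ℝ) : ℝ :=
  2 * Real.logb b x - 2 * Real.logb b (Real.logb b (x * (1 - 1 / b)))
    + 2 * Real.logb b (Real.exp 1 / 2) + 1

variable {b : ℝ}

theorem tendsto_logb_mul_one_sub (hb : 1 < b) :
    Tendsto (fun x => Real.logb b (x * (1 - 1 / b))) atTop atTop := by
  have h : 0 < 1 - 1 / b := by
    rw [sub_pos, div_lt_one (by linarith)]; exact hb
  exact (Real.tendsto_logb_atTop hb).comp (tendsto_id.atTop_mul_const h)

/-- With `K` the inner logarithm, the typical size is `2K - 2 log_b K + C`. The logarithm of this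
ratio is the only error made by taking `typicalSize` as the crossing point. -/
theorem tendsto_typicalSize_div (hb : 1 < b) :
    Tendsto (fun x => typicalSize b x / (2 * Real.logb b (x * (1 - 1 / b)))) atTop (𝓝 1) := by
  have hK := tendsto_logb_mul_one_sub hb
  have h : 0 < 1 - 1 / b := by
    rw [sub_pos, div_lt_one (by linarith)]; exact hb
  set C := -2 * Real.logb b (1 - 1 / b) + 2 * Real.logb b (Real.exp 1 / 2) + 1
  have h1 : Tendsto (fun k : ℝ => 1 + C / 2 * k⁻¹ - (Real.log b)⁻¹ * (Real.log k / k)) atTop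
      (𝓝 (1 + C / 2 * 0 - (Real.log b)⁻¹ * 0)) :=
    ((tendsto_inv_atTop_zero.const_mul _).const_add _).sub
      (Real.isLittleO_log_id_atTop.tendsto_div_nhds_zero.const_mul _)
  have h2 := h1.comp hK
  simp only [mul_zero, add_zero, sub_zero] at h2
  refine h2.congr' ?_
  filter_upwards [hK.eventually_gt_atTop 0, eventually_gt_atTop 0] with x hKx hx
  have e : Real.logb b x = Real.logb b (x * (1 - 1 / b)) - Real.logb b (1 - 1 / b) := by
    rw [Real.logb_mul hx.ne' h.ne']; ring
  have hlog : Real.log b ≠ 0 := (Real.log_pos hb).ne'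
  rw [typicalSize, e]
  simp only [Function.comp, C]
  rw [← Real.log_div_log (x := Real.logb b (x * (1 - 1 / b)))]
  generalize Real.logb b (x * (1 - 1 / b)) = k at hKx ⊢
  field_simp
  ring

theorem tendsto_typicalSize (hb : 1 < b) : Tendsto (typicalSize b) atTop atTop := by
  have hK := tendsto_logb_mul_one_sub hb
  refine ((hK.const_mul_atTop two_pos).atTop_mul_pos one_pos (tendsto_typicalSize_div hb)).congr' ?_
  filter_upwards [hK.eventually_gt_atTop 0] with x hKx
  exact mul_div_cancel₀ _ (mul_ne_zero two_ne_zero hKx.ne')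

theorem eventually_typicalSize_le (hb : 1 < b) :
    ∀ᶠ x in atTop, typicalSize b x ≤ 2 * Real.logb b x := by
  filter_upwards [((Real.tendsto_logb_atTop hb).comp (tendsto_logb_mul_one_sub hb)).eventually_ge_atTop
    ((2 * Real.logb b (Real.exp 1 / 2) + 1) / 2)] with x hx
  simp only [Function.comp] at hx
  unfold typicalSize
  linarith

variable {s σ : ℝ}

theorem one_lt_zpow_neg_two (hs : 0 < s) (hs1 : s < 1) : 1 < s ^ (-2 : ℤ) :=
  one_lt_zpow_of_neg₀ hs hs1 (by norm_num)

theorem two_mul_logb_mul_log_inv (hs : 0 < s) (hs1 : s < 1) (y : ℝ) :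
    2 * Real.logb (s ^ (-2 : ℤ)) y * Real.log s⁻¹ = Real.log y := by
  have h := Real.log_neg hs hs1
  rw [← Real.log_div_log, Real.log_zpow, Real.log_inv]
  have hne := h.ne
  push_cast
  field_simp

theorem typicalSize_sub_one_mul (hs : 0 < s) (hs1 : s < 1) (x : ℝ) :
    (typicalSize (s ^ (-2 : ℤ)) x - 1) * Real.log s⁻¹ = Real.log x
      - Real.log (Real.logb (s ^ (-2 : ℤ)) (x * (1 - 1 / s ^ (-2 : ℤ)))) + 1 - Real.log 2 := by
  have h := two_mul_logb_mul_log_inv hs hs1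
  have h2 : Real.log (Real.exp 1 / 2) = 1 - Real.log 2 := by
    rw [Real.log_div (Real.exp_ne_zero _) two_ne_zero, Real.log_exp]
  rw [typicalSize, ← h (Real.logb _ (x * (1 - 1 / s ^ (-2 : ℤ))))]
  linear_combination h x + h (Real.exp 1 / 2) + h2

theorem log_sizeRatio (hs : 0 < s) {x : ℝ} (hx : 0 < x) {r : ℕ} (hr : 1 ≤ r) :
    Real.log (r * s⁻¹ ^ (r - 1) / (Real.exp 1 * x)) =
      Real.log r + (r - 1) * Real.log s⁻¹ - 1 - Real.log x := by
  have hr0 : (0 : ℝ) < r := by exact_mod_cast hr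
  have hsi : 0 < s⁻¹ := inv_pos.2 hs
  rw [Real.log_div (by positivity) (by positivity), Real.log_mul (by positivity) (by positivity),
    Real.log_mul (by positivity) (by positivity), Real.log_pow, Real.log_exp, Nat.cast_sub hr]
  push_cast
  ring

/-- At `r = z`, the typical size, the logarithm of the ratio would be `log (z/(2K)) → 0`. A shift of
`r` by `σ` changes it by at least `σ log s⁻¹`; half of this absorbs the error. -/
theorem eventually_sizeRatio (hs : 0 < s) (hs1 : s < 1) (hσ : 0 < σ) :
    ∀ᶠ x in atTop, ∀ r : ℕ, 1 ≤ r →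
      (typicalSize (s ^ (-2 : ℤ)) x + σ ≤ r →
        Real.exp (σ * Real.log s⁻¹ / 2) ≤ r * s⁻¹ ^ (r - 1) / (Real.exp 1 * x)) ∧
      (r ≤ typicalSize (s ^ (-2 : ℤ)) x - σ →
        r * s⁻¹ ^ (r - 1) / (Real.exp 1 * x) ≤ Real.exp (-(σ * Real.log s⁻¹ / 2))) := by
  have hb := one_lt_zpow_neg_two hs hs1
  have hκ : 0 < Real.log s⁻¹ := Real.log_pos ((one_lt_inv₀ hs).2 hs1)
  have hlog : Tendsto (fun x => Real.log (typicalSize (s ^ (-2 : ℤ)) x /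
      (2 * Real.logb (s ^ (-2 : ℤ)) (x * (1 - 1 / s ^ (-2 : ℤ)))))) atTop (𝓝 0) := by
    simpa using (tendsto_typicalSize_div hb).log one_ne_zero
  have hpos : 0 < σ * Real.log s⁻¹ / 2 := by positivity
  filter_upwards [hlog.eventually_lt_const hpos,
    hlog.eventually_const_lt (neg_lt_zero.2 hpos),
    (tendsto_typicalSize hb).eventually_gt_atTop 0,
    (tendsto_logb_mul_one_sub hb).eventually_gt_atTop 0, eventually_gt_atTop 0]
    with x h1 h2 hz hK hx r hr
  have hr0 : (0 : ℝ) < r := by exact_mod_cast hr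
  have hsi : 0 < s⁻¹ := inv_pos.2 hs
  have hF : 0 < r * s⁻¹ ^ (r - 1) / (Real.exp 1 * x) := by positivity
  have hcen := typicalSize_sub_one_mul hs hs1 x
  rw [Real.log_div hz.ne' (by positivity), Real.log_mul two_ne_zero hK.ne'] at h1 h2
  refine ⟨fun h => ?_, fun h => ?_⟩
  · rw [← Real.le_log_iff_exp_le hF, log_sizeRatio hs hx hr]
    have h3 : Real.log (typicalSize (s ^ (-2 : ℤ)) x) ≤ Real.log r :=
      Real.log_le_log hz (by linarith)
    have h4 := mul_le_mul_of_nonneg_right h hκ.le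
    linarith
  · rw [← Real.log_le_iff_le_exp hF, log_sizeRatio hs hx hr]
    have h3 : Real.log r ≤ Real.log (typicalSize (s ^ (-2 : ℤ)) x) :=
      Real.log_le_log hr0 (by linarith)
    have h4 := mul_le_mul_of_nonneg_right h hκ.le
    linarith

/-- The expected number of compatible sets larger than the typical size vanishes. -/
theorem eventually_firstMoment_le (hs : 0 < s) (hs1 : s < 1) (hσ : 0 < σ) :
    ∀ᶠ x in atTop, ∀ (n r : ℕ) (a : ℝ), 0 < a → n * a = x →
      typicalSize (s ^ (-2 : ℤ)) x + σ ≤ r →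
      n.choose r * compatProb a s r ≤
        Real.exp (-(σ * Real.log s⁻¹ / 2 * typicalSize (s ^ (-2 : ℤ)) x)) := by
  have hb := one_lt_zpow_neg_two hs hs1
  have hκ : 0 < Real.log s⁻¹ := Real.log_pos ((one_lt_inv₀ hs).2 hs1)
  filter_upwards [eventually_sizeRatio hs hs1 hσ, (tendsto_typicalSize hb).eventually_gt_atTop 0,
    eventually_gt_atTop 0] with x h hz hx n r a ha hna hr
  have hr0 : (0 : ℝ) < r := by linarith
  have hr1 : 1 ≤ r := by exact_mod_cast hr0
  refine (choose_mul_compatProb_le ha hs n hr1).trans ?_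
  have h1 := ((h r hr1).1 hr)
  have h2 : Real.exp 1 * (n * a) * s ^ (r - 1) / r ≤ Real.exp (-(σ * Real.log s⁻¹ / 2)) := by
    rw [Real.exp_neg]
    refine le_trans (le_of_eq ?_) (inv_anti₀ (Real.exp_pos _) h1)
    rw [hna, inv_pow]
    field_simp
  calc (Real.exp 1 * (n * a) * s ^ (r - 1) / r) ^ r
      ≤ Real.exp (-(σ * Real.log s⁻¹ / 2)) ^ r := by
        gcongr
    _ = Real.exp (-(σ * Real.log s⁻¹ / 2 * r)) := by rw [← Real.exp_nat_mul]; ring_nf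
    _ ≤ _ := by
        gcongr
        linarith

theorem tendsto_exp_neg_mul_typicalSize (hs : 0 < s) (hs1 : s < 1) (hσ : 0 < σ) :
    Tendsto (fun x => Real.exp (-(σ * Real.log s⁻¹ / 2 * typicalSize (s ^ (-2 : ℤ)) x))) atTop
      (𝓝 0) := by
  have hκ : 0 < Real.log s⁻¹ := Real.log_pos ((one_lt_inv₀ hs).2 hs1)
  exact Real.tendsto_exp_neg_atTop_nhds_zero.comp
    ((tendsto_typicalSize (one_lt_zpow_neg_two hs hs1)).const_mul_atTop (by positivity))

/-- An upper bound for the probability that no compatible set reaches the typical size. -/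
noncomputable def secondMomentBound (s σ x : ℝ) : ℝ :=
  2 * Real.logb (s ^ (-2 : ℤ)) x * (2 * ((2 * Real.logb (s ^ (-2 : ℤ)) x) ^ 2 / √x +
    Real.exp 1 * (2 * Real.logb (s ^ (-2 : ℤ)) x) * Real.exp (-(σ / 4 * Real.log x))))

theorem tendsto_log_pow_mul_exp_neg_mul_log (k : ℕ) {c : ℝ} (hc : 0 < c) :
    Tendsto (fun x => Real.log x ^ k * Real.exp (-(c * Real.log x))) atTop (𝓝 0) := by
  have h := (tendsto_rpow_mul_exp_neg_mul_atTop_nhds_zero k c hc).comp Real.tendsto_log_atTop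
  refine h.congr fun x => ?_
  simp [Function.comp]

theorem exp_neg_half_mul_log {x : ℝ} (hx : 0 < x) :
    Real.exp (-(1 / 2 * Real.log x)) = (√x)⁻¹ := by
  rw [Real.exp_neg, Real.sqrt_eq_rpow, Real.rpow_def_of_pos hx, mul_comm]

theorem tendsto_secondMomentBound (hs : 0 < s) (hs1 : s < 1) (hσ : 0 < σ) :
    Tendsto (secondMomentBound s σ) atTop (𝓝 0) := by
  have hκ : 0 < Real.log s⁻¹ := Real.log_pos ((one_lt_inv₀ hs).2 hs1)
  have h1 := (tendsto_log_pow_mul_exp_neg_mul_log 3 (c := 1 / 2) (by norm_num)).const_mul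
    (2 / Real.log s⁻¹ ^ 3)
  have h2 := (tendsto_log_pow_mul_exp_neg_mul_log 2 (c := σ / 4) (by positivity)).const_mul
    (2 * Real.exp 1 / Real.log s⁻¹ ^ 2)
  have h := h1.add h2
  simp only [mul_zero, add_zero] at h
  refine h.congr' ?_
  filter_upwards [eventually_gt_atTop 0] with x hx
  have e : 2 * Real.logb (s ^ (-2 : ℤ)) x = Real.log x / Real.log s⁻¹ := by
    rw [eq_div_iff hκ.ne', two_mul_logb_mul_log_inv hs hs1]
  rw [secondMomentBound, e, exp_neg_half_mul_log hx]
  field_simp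

theorem eventually_sq_two_mul_logb_le (hs : 0 < s) (hs1 : s < 1) :
    ∀ᶠ x in atTop, (2 * Real.logb (s ^ (-2 : ℤ)) x) ^ 2 ≤ √x := by
  have hκ : 0 < Real.log s⁻¹ := Real.log_pos ((one_lt_inv₀ hs).2 hs1)
  have h := (tendsto_log_pow_mul_exp_neg_mul_log 2 (c := 1 / 2) (by norm_num)).eventually_lt_const
    (show 0 < Real.log s⁻¹ ^ 2 by positivity)
  filter_upwards [h, eventually_gt_atTop 0] with x hlt hx
  have e : 2 * Real.logb (s ^ (-2 : ℤ)) x = Real.log x / Real.log s⁻¹ := by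
    rw [eq_div_iff hκ.ne', two_mul_logb_mul_log_inv hs hs1]
  have hsx := Real.sqrt_pos.2 hx
  rw [exp_neg_half_mul_log hx, ← div_eq_mul_inv, div_lt_iff₀ hsx] at hlt
  rw [e, div_pow, div_le_iff₀ (by positivity)]
  linarith

/-- The second moment bound vanishes for sets smaller than the typical size. -/
theorem eventually_secondMoment_le (hs : 0 < s) (hs1 : s < 1) (hσ : 0 < σ) :
    ∀ᶠ x in atTop, ∀ (n r : ℕ) (a : ℝ), 0 < a → a ≤ 1 → n * a = x →
      r ≤ typicalSize (s ^ (-2 : ℤ)) x - σ →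
      r ≤ n ∧ ∑ l ∈ Finset.Icc 1 r, (r.choose l : ℝ) ^ 2 / (n.choose l * compatProb a s l) ≤
        secondMomentBound s σ x := by
  have hb := one_lt_zpow_neg_two hs hs1
  have hκ : 0 < Real.log s⁻¹ := Real.log_pos ((one_lt_inv₀ hs).2 hs1)
  filter_upwards [eventually_sizeRatio hs hs1 hσ, eventually_typicalSize_le hb,
    eventually_sq_two_mul_logb_le hs hs1, eventually_ge_atTop 4]
    with x hF hz hsq hx4 n r a ha ha1 hna hr
  have hx : 0 < x := by linarith
  set Y := 2 * Real.logb (s ^ (-2 : ℤ)) x with hY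
  have hrY : (r : ℝ) ≤ Y := by linarith
  have hr0 : (0 : ℝ) ≤ r := Nat.cast_nonneg r
  have hrx : (r : ℝ) ^ 2 ≤ √x := le_trans (by gcongr) hsq
  have hsx : 2 ≤ √x := Real.le_sqrt_of_sq_le (by linarith)
  have hxn : x ≤ n := by
    rw [← hna]
    exact mul_le_of_le_one_right (Nat.cast_nonneg n) ha1
  -- `2r² ≤ 2√x ≤ x ≤ n`, using `x ≥ 4` and `a ≤ 1`.
  have hn : 2 * r ^ 2 ≤ n := by
    have : (2 : ℝ) * (r : ℝ) ^ 2 ≤ n := by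
      nlinarith [Real.mul_self_sqrt hx.le]
    exact_mod_cast this
  refine ⟨by nlinarith, ?_⟩
  set η := Real.exp (-(σ / 4 * Real.log x)) with hη
  have hterm : ∀ l ∈ Finset.Icc 1 r, (r.choose l : ℝ) ^ 2 / (n.choose l * compatProb a s l) ≤
      2 * (Y ^ 2 / √x + Real.exp 1 * Y * η) := by
    intro l hl
    obtain ⟨hl1, hlr⟩ := Finset.mem_Icc.1 hl
    refine (choose_sq_div_le (x := x) ha hs hna hx hl1 hlr hn hrx (Real.exp_pos _)
      (Real.exp_pos (-(σ / 4 * Real.log x))) ((hF r (hl1.trans hlr)).2 hr) ?_ hs1.le).trans ?_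
    -- Logarithms give `(l-1) log s⁻¹ > (log x)/2`, so `θ^l = exp(-lσ log s⁻¹/2)` is at most
    -- `exp(-(σ/4) log x)`.
    · intro hlt
      have h1 := Real.log_lt_log (by positivity) hlt
      rw [Real.log_pow, Real.log_sqrt hx.le, Nat.cast_sub hl1] at h1
      rw [← Real.exp_nat_mul, Real.exp_le_exp]
      push_cast at h1
      nlinarith
    · gcongr
  refine (Finset.sum_le_card_nsmul _ _ _ hterm).trans ?_
  rw [Nat.card_Icc, Nat.add_sub_cancel, nsmul_eq_mul, secondMomentBound]
  have hY0 : 0 ≤ Y := hr0.trans hrY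
  gcongr

end Asymptotics

/-! ### Concentration of the number of active links -/

theorem corollary1 {Ω : ℕ → Type*} [∀ n, MeasurableSpace (Ω n)] (P : ∀ n, Measure (Ω n))
    [∀ n, IsProbabilityMeasure (P n)]
    (g : ∀ n, Fin n → Fin n → Ω n → ℝ) (hg : ∀ n, IsRayleighFading (P n) (g n))
    (Δ : ℕ → ℝ) (hΔ : ∀ᶠ n in atTop, 0 ≤ Δ n)
    (hΔn : Tendsto (fun n : ℕ => (n : ℝ) * Real.exp (-Δ n)) atTop atTop)
    (δ : ℝ) (hδ : 0 < δ)
    (A : ∀ n, Ω n → Finset (Fin n))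
    (hA : ∀ n ω, IsDTBLASActiveSet (fun j i => g n j i ω) (Δ n) δ (A n ω))
    (ε : ℝ) (hε : 0 < ε) :
    ∃ u v : ℕ → ℝ, Tendsto u atTop (𝓝 0) ∧ Tendsto v atTop (𝓝 0) ∧
      Tendsto
        (fun n : ℕ => P n {ω |
          activeLinksBound δ (n * Real.exp (-Δ n)) (-(ε / edgeProb δ)) (u n)
              ≤ ((A n ω).card : ℤ) ∧
          ((A n ω).card : ℤ)
              ≤ activeLinksBound δ (n * Real.exp (-Δ n)) (ε / edgeProb δ) (v n)})
        atTop (𝓝 1) := by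
  -- The margin `σ` already absorbs every vanishing error, so both `o(1)` terms can be zero.
  refine ⟨fun _ => 0, fun _ => 0, tendsto_const_nhds, tendsto_const_nhds, ?_⟩
  have hs : 0 < 1 - Real.exp (-δ) := by simpa using hδ
  have hs1 : 1 - Real.exp (-δ) < 1 := by linarith [Real.exp_pos (-δ)]
  have hσ : 0 < ε / edgeProb δ := div_pos hε (by unfold edgeProb; positivity)
  set s := 1 - Real.exp (-δ) with hs_def
  set σ := ε / edgeProb δ
  set X : ℕ → ℝ := fun n => n * Real.exp (-Δ n)
  have hbound : Tendsto (fun n => 1 - ENNReal.ofReal (secondMomentBound s σ (X n) +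
      Real.exp (-(σ * Real.log s⁻¹ / 2 * typicalSize (s ^ (-2 : ℤ)) (X n))))) atTop (𝓝 1) := by
    have h := ((tendsto_secondMomentBound hs hs1 hσ).add
      (tendsto_exp_neg_mul_typicalSize hs hs1 hσ)).comp hΔn
    have h2 := ENNReal.Tendsto.sub (tendsto_const_nhds (x := (1 : ENNReal)))
      (ENNReal.tendsto_ofReal h) (Or.inl ENNReal.one_ne_top)
    simpa using h2
  refine tendsto_of_tendsto_of_tendsto_of_le_of_le' hbound tendsto_const_nhds ?_
    (Eventually.of_forall fun n => prob_le_one)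
  filter_upwards [hΔ, hΔn.eventually (eventually_firstMoment_le hs hs1 hσ),
    hΔn.eventually (eventually_secondMoment_le hs hs1 hσ),
    hΔn.eventually ((tendsto_typicalSize (one_lt_zpow_neg_two hs hs1)).eventually_gt_atTop 0),
    hΔn.eventually ((tendsto_typicalSize (one_lt_zpow_neg_two hs hs1)).eventually_gt_atTop σ)]
    with n hΔn0 hfirst hsecond hz hzσ
  set z := typicalSize (s ^ (-2 : ℤ)) (X n)
  have hbd : ∀ t, activeLinksBound δ (X n) t 0 = ⌊z + t⌋ := by
    intro t
    rw [activeLinksBound, add_zero]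
    rfl
  -- The smallest size excluded by the upper bound, and the size demanded by the lower one. Natural
  -- and integer floors agree because `z > σ`.
  set hi := ⌊z + σ⌋₊ + 1
  set lo := ⌊z - σ⌋₊
  have ha1 : Real.exp (-Δ n) ≤ 1 := by simpa using hΔn0
  have hhi : z + σ ≤ (hi : ℕ) := by
    push_cast [hi]
    exact (Nat.lt_floor_add_one _).le
  have hlo : (lo : ℝ) ≤ z - σ := Nat.floor_le (by linarith)
  obtain ⟨hlon, hlo2⟩ := hsecond n lo _ (Real.exp_pos _) ha1 rfl hlo
  have hup : (P n).real {ω | hi ≤ (A n ω).card} ≤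
      Real.exp (-(σ * Real.log s⁻¹ / 2 * z)) := by
    simp_rw [(hA n _).le_card_iff]
    exact ((hg n).measureReal_le_card_le hΔn0 hδ.le hi).trans
      (hfirst n hi _ (Real.exp_pos _) rfl hhi)
  have hdown : (P n).real {ω | ¬ lo ≤ (A n ω).card} ≤ secondMomentBound s σ (X n) := by
    simp_rw [(hA n _).le_card_iff]
    push Not
    exact ((hg n).measureReal_forall_not_le hΔn0 hδ hlon).trans hlo2
  set G := {ω | activeLinksBound δ (X n) (-σ) 0 ≤ ((A n ω).card : ℤ) ∧
    ((A n ω).card : ℤ) ≤ activeLinksBound δ (X n) σ 0} with hG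
  -- Covering the whole space and using subadditivity requires no measurability of `G`.
  have hcover : Set.univ ⊆ G ∪ ({ω | ¬ lo ≤ (A n ω).card} ∪ {ω | hi ≤ (A n ω).card}) := by
    intro ω _
    by_cases h1 : lo ≤ (A n ω).card
    · by_cases h2 : hi ≤ (A n ω).card
      · exact Or.inr (Or.inr h2)
      · refine Or.inl ⟨?_, ?_⟩
        · rw [hbd, ← sub_eq_add_neg, ← Int.natCast_floor_eq_floor (by linarith)]
          exact_mod_cast h1
        · rw [hbd, ← Int.natCast_floor_eq_floor (by linarith)]
          exact_mod_cast Nat.le_of_lt_succ (not_le.1 h2)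
    · exact Or.inr (Or.inl h1)
  rw [tsub_le_iff_right]
  calc (1 : ENNReal) = P n Set.univ := measure_univ.symm
    _ ≤ P n G + (P n {ω | ¬ lo ≤ (A n ω).card} + P n {ω | hi ≤ (A n ω).card}) :=
        (measure_mono hcover).trans ((measure_union_le _ _).trans
          (by gcongr; exact measure_union_le _ _))
    _ ≤ _ := by
        gcongr
        rw [← ofReal_measureReal, ← ofReal_measureReal,
          ← ENNReal.ofReal_add measureReal_nonneg measureReal_nonneg]
        exact ENNReal.ofReal_le_ofReal (add_le_add hdown hup)
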